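/- For a finite group $G$, let $\mathrm{nse}(G)$ be the set of the numbers $m_i(G)=|\{x\in G : x \text{ has order } i\}|$, where $i$ runs over the orders of elements of $G$. The prime graph $\Gamma(G)$ has as vertices the primes dividing $|G|$, and two distinct vertices $p$ and $r$ are adjacent if and only if $G$ has an element of order $pr$. For a positive integer $n$, let $\pi(n)$ be the set of prime divisors of $n$. Let $q=2^f>2$, let $\mathrm{PSp}_4(q)$ be the symplectic group $\mathrm{Sp}_4(q)$ over the field with $q$ elements modulo its centre, and let $G$ be a finite group with $|G|=|\mathrm{PSp}_4(q)|$ and $\mathrm{nse}(G)=\mathrm{nse}(\mathrm{PSp}_4(q))$. Then all primes in $\pi(q^2+1)$ and $\pi(2(q^2-1))$ are vertices of $\Gamma(G)$, and no connected component of $\Gamma(G)$ contains both a prime in $\pi(q^2+1)$ and a prime in $\pi(2(q^2-1))$. In particular, $\Gamma(G)$ has at least two connected components, that is, it is disconnected. -/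

import Mathlib

/-- The projective symplectic group `PSp_{2n}(F)`, `n = |l|`: the quotient of the symplectic group
`Sp_{2n}(F)` by its centre. `PSp_4(F)` is the case `l = Fin 2`. -/
abbrev PSp (l F : Type*) [DecidableEq l] [Fintype l] [Field F] : Type _ :=
  Matrix.symplecticGroup l F ⧸ Subgroup.center (Matrix.symplecticGroup l F)

/-- The spectrum `ω(G)`: the set of orders of elements of `G`. -/
def elementOrders (G : Type*) [Group G] : Set ℕ :=
  Set.range (fun x : G => orderOf x)

/-- `m_i(G)`: the number of elements of order `i` in `G`. -/
noncomputable def numOfOrder (G : Type*) [Group G] (i : ℕ) : ℕ :=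
  Nat.card {x : G // orderOf x = i}

/-- `nse(G)`: the set of the numbers `m_i(G)` for `i ∈ ω(G)`. -/
def nse (G : Type*) [Group G] : Set ℕ :=
  numOfOrder G '' elementOrders G

/-- The prime graph of a finite group `G`: the vertices are the primes dividing `|G|`, and two
distinct vertices `p`, `r` are adjacent if and only if `p * r` is the order of an element. -/
def primeGraph (G : Type*) [Group G] : SimpleGraph {p : ℕ // p ∈ (Nat.card G).primeFactors} where
  Adj p r := p ≠ r ∧ (p : ℕ) * (r : ℕ) ∈ elementOrders G
  symm := ⟨fun p r h => ⟨h.1.symm, by rw [mul_comm]; exact h.2⟩⟩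
  loopless := ⟨fun _ h => h.1 rfl⟩

/-!
The proof compares two coprime divisors of the common order `n * m`, where `n = q ^ 2 + 1` and
`m = q ^ 4 * (q ^ 2 - 1) ^ 2`, and shows that no element of `G` has order `u * r` with `u ∣ n` and
`r ∣ m` prime. Since `π(n)` and `π(m) = π(2 * (q ^ 2 - 1))` partition the vertices of the prime
graph, they are then unions of components.

*What is needed from `Sp₄(q)`.* For every `o ≠ 1` the number `m_o` of elements of order `o` is
divisible by `n` or by `m` (`dvd_numOfOrder_of_centralizers`). Indeed an element of prime order
`u ∣ q ^ 2 + 1` acts irreducibly, because `q` has order `4` modulo `u`; so its centralizer lies in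
the field of polynomials in it, where the symplectic adjoint is `y ↦ y ^ q ^ 2`, and it is cyclic of
order dividing `n` (`card_centralizer_dvd_of_prime_orderOf`). Therefore the centralizer of any
`x ≠ 1` has order prime to `n` or dividing `n` (`card_centralizer_coprime_or_dvd`), and the
class of `x` has size divisible by `n` or by `m`. The order of `Sp₄(q)` is found by counting
symplectic bases, and its centre is trivial by the statement on centralizers, so that
`PSp₄(q) = Sp₄(q)`. The number of involutions is odd and different from `1`, which shows that the
value `1` is taken only by `m_1` in `G` as well (`dvd_numOfOrder_of_nse_eq`).

*The argument in `G`.* By a special case of Frobenius' theorem, `n` divides the number of `x`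
for which `x ^ n` has a given order, and likewise for `m` (`dvd_card_orderOf_pow_eq`). Fix `j ≠ 1`
and look at the orders `o` of the elements `x` with `x ^ n` of order `j`: those with `m_o` not
divisible by `n` have `m_o` divisible by `m`, so their sum is a multiple of `n * m = |G|` that is
less than `|G|`, and there are none (`dvd_numOfOrder_of_not_dvd`). Now let `u` be a prime divisor of
`n`. As `m_u ≡ -1` modulo `u`, `m` divides `m_u`, hence also the number of `x` of order different
from `u` with `x ^ m` of order `u`. That number is divisible by `n` as well by what was just shown,
so it is `0` (`mul_not_mem_elementOrders`).
-/

/-! ### A special case of Frobenius' theorem -/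

open Subgroup in
/-- The class of `c` has as many elements as the centralizer of `c` has cosets. -/
theorem card_conjClass_mul_card_centralizer {G : Type*} [Group G] [Finite G] (c : G) :
    Nat.card {x : G // ConjClasses.mk x = ConjClasses.mk c} * Nat.card (centralizer {c}) =
      Nat.card G := by
  rw [nat_card_centralizer_nat_card_stabilizer]
  have h := Nat.card_congr (MulAction.orbitProdStabilizerEquivGroup (ConjAct G) c)
  rw [Nat.card_prod] at h
  rw [show Nat.card G = Nat.card (ConjAct G) from rfl, ← h]
  congr 1
  refine Nat.card_congr (Equiv.subtypeEquivRight fun x => ?_)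
  rw [ConjClasses.mk_eq_mk_iff_isConj, ConjAct.mem_orbit_conjAct]

/-- A conjugation-invariant weight, summed over a union of conjugacy classes, is divisible by any
number that divides the contribution of each class. -/
theorem dvd_sum_of_conj_invariant {G : Type*} [Group G] [Finite G] (d : ℕ) (f : G → ℕ)
    (hf : ∀ x y, IsConj x y → f x = f y) (T : Finset G)
    (hT : ∀ x y, IsConj x y → x ∈ T → y ∈ T)
    (hd : ∀ c ∈ T, d ∣ Nat.card {x : G // ConjClasses.mk x = ConjClasses.mk c} * f c) :
    d ∣ ∑ c ∈ T, f c := by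
  classical
  have := Fintype.ofFinite G
  rw [← Finset.sum_fiberwise_of_maps_to (t := T.image ConjClasses.mk)
    (g := ConjClasses.mk) (fun x hx => Finset.mem_image_of_mem _ hx)]
  refine Finset.dvd_sum fun κ hκ => ?_
  obtain ⟨c, hc, rfl⟩ := Finset.mem_image.1 hκ
  have h1 : ∑ x ∈ T with ConjClasses.mk x = ConjClasses.mk c, f x =
      ∑ x ∈ T with ConjClasses.mk x = ConjClasses.mk c, f c :=
    Finset.sum_congr rfl fun x hx =>
      hf _ _ (ConjClasses.mk_eq_mk_iff_isConj.1 (Finset.mem_filter.1 hx).2)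
  rw [h1, Finset.sum_const, smul_eq_mul]
  suffices h2 : (T.filter fun x => ConjClasses.mk x = ConjClasses.mk c).card =
      Nat.card {x : G // ConjClasses.mk x = ConjClasses.mk c} by
    rw [h2]; exact hd c hc
  rw [Nat.card_eq_fintype_card, Fintype.card_subtype]
  congr 1
  ext x
  simp only [Finset.mem_filter, Finset.mem_univ, true_and, and_iff_right_iff_imp]
  exact fun hx => hT _ _ (ConjClasses.mk_eq_mk_iff_isConj.1 hx).symm hc

/-- If `n` and `m` are coprime and `c ^ m = 1`, then `c` has a unique `n`-th root among its powers,
and dividing by it identifies the `n`-th roots of `c` with the `n`-th roots of `1` in the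
centralizer of `c`. -/
theorem card_pow_eq_of_pow_eq_one {G : Type*} [Group G] {n m : ℕ} (hnm : n.Coprime m) {c : G}
    (hc : c ^ m = 1) :
    Nat.card {x : G // x ^ n = c} =
      Nat.card {a : Subgroup.centralizer {c} // a ^ n = 1} := by
  obtain ⟨b, hb, hbc⟩ : ∃ b : G, b ^ n = c ∧ b ∈ Subgroup.zpowers c := by
    obtain ⟨k, hk⟩ : ∃ k : ℤ, c ^ (k * n) = c := by
      refine ⟨Nat.gcdA n m, ?_⟩
      have h := Nat.gcd_eq_gcd_ab n m
      rw [hnm.gcd_eq_one] at h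
      have h2 : Nat.gcdA n m * (n : ℤ) = 1 - m * Nat.gcdB n m := by push_cast at h; linarith
      rw [h2, zpow_sub, zpow_one, zpow_mul, zpow_natCast, hc, one_zpow, inv_one, mul_one]
    exact ⟨c ^ k, by rw [← zpow_natCast, ← zpow_mul, hk], Subgroup.zpow_mem_zpowers c k⟩
  have key : ∀ x : G, x * c = c * x → Commute x b := by
    intro x hx
    obtain ⟨k, rfl⟩ := hbc
    exact Commute.zpow_right hx k
  have hbcent : b * c = c * b := by rw [← hb]; exact ((Commute.refl b).pow_right n).eq
  refine Nat.card_congr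
    { toFun := fun x => ⟨⟨x.1 * b⁻¹, ?_⟩, ?_⟩
      invFun := fun a => ⟨a.1.1 * b, ?_⟩
      left_inv := fun x => by simp
      right_inv := fun a => by simp }
  · have hx : x.1 * c = c * x.1 := by
      have h := ((Commute.refl x.1).pow_right n).eq
      rwa [x.2] at h
    rw [Subgroup.mem_centralizer_singleton_iff]
    exact (Commute.mul_left (show Commute x.1 c from hx)
      (Commute.inv_left (show Commute b c from hbcent))).eq
  · have hx : x.1 * c = c * x.1 := by
      have h := ((Commute.refl x.1).pow_right n).eq
      rwa [x.2] at h
    apply Subtype.ext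
    change (x.1 * b⁻¹) ^ n = 1
    rw [(key _ hx).inv_right.mul_pow, x.2, inv_pow, hb, mul_inv_cancel]
  · have ha := Subgroup.mem_centralizer_singleton_iff.1 a.1.2
    have h1 : a.1.1 ^ n = 1 := congrArg Subtype.val a.2
    rw [(key _ ha).mul_pow, h1, one_mul, hb]

theorem card_pow_eq_conj {G : Type*} [Group G] (n : ℕ) {c d : G} (h : IsConj c d) :
    Nat.card {x : G // x ^ n = c} = Nat.card {x : G // x ^ n = d} := by
  obtain ⟨g, rfl⟩ := isConj_iff.1 h
  refine Nat.card_congr ((MulAut.conj g).toEquiv.subtypeEquiv fun x => ?_)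
  change _ ↔ (MulAut.conj g x) ^ n = g * c * g⁻¹
  rw [← map_pow, ← MulAut.conj_apply, EmbeddingLike.apply_eq_iff_eq]

/-- The contribution of the conjugacy class of `c` to the count of `n`-th roots. -/
theorem gcd_dvd_card_conjClass_mul {G : Type*} [Group G] [Finite G] {n k : ℕ} {c : G}
    (h : n.gcd (Nat.card (Subgroup.centralizer {c})) ∣ k) :
    n.gcd (Nat.card G) ∣
      Nat.card {x : G // ConjClasses.mk x = ConjClasses.mk c} * k := by
  refine dvd_trans ?_ (mul_dvd_mul_left _ h)
  rw [← card_conjClass_mul_card_centralizer c, ← Nat.gcd_mul_left]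
  exact Nat.dvd_gcd ((Nat.gcd_dvd_left _ _).mul_left _) (Nat.gcd_dvd_right _ _)

/-- A special case of Frobenius' theorem, by induction on `|G|`: sort the elements of `G` by their
`n`-th power `c`. For `c` not central the number of roots is known from the centralizer of `c`, and
all central `c` with `c ^ m = 1` contribute the same number. -/
theorem gcd_dvd_card_pow_eq_one {n m : ℕ} (hnm : n.Coprime m) (G : Type*) [Group G] [Finite G]
    (hG : Nat.card G ∣ n * m) :
    n.gcd (Nat.card G) ∣ Nat.card {x : G // x ^ n = 1} := by
  classical
  induction hN : Nat.card G using Nat.strong_induction_on generalizing G with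
  | _ N ih =>
  subst hN
  have := Fintype.ofFinite G
  -- As `x ^ (n * m) = 1` for all `x`, only the `c` with `c ^ m = 1` have `n`-th roots.
  have hroot : ∀ c : G, c ^ m ≠ 1 → Nat.card {x : G // x ^ n = c} = 0 := by
    intro c hc
    rw [Nat.card_eq_zero]
    left
    refine ⟨fun x => hc ?_⟩
    rw [← x.2, ← pow_mul]
    obtain ⟨k, hk⟩ := hG
    rw [hk, pow_mul, pow_card_eq_one', one_pow]
  have htot : Nat.card G = ∑ c : G, Nat.card {x : G // x ^ n = c} := by
    rw [← Nat.card_sigma]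
    exact Nat.card_congr (Equiv.sigmaFiberEquiv fun x : G => x ^ n).symm
  have hnc : n.gcd (Nat.card G) ∣
      ∑ c with c ∉ Subgroup.center G, Nat.card {x : G // x ^ n = c} := by
    refine dvd_sum_of_conj_invariant _ _ (fun x y h => card_pow_eq_conj n h) _ ?_ ?_
    · intro x y hxy hx
      simp only [Finset.mem_filter, Finset.mem_univ, true_and] at hx ⊢
      intro hy
      obtain ⟨g, rfl⟩ := isConj_iff.1 hxy
      have := (inferInstance : (Subgroup.center G).Normal).conj_mem _ hy g⁻¹
      apply hx
      simpa [mul_assoc] using this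
    · intro c hc
      simp only [Finset.mem_filter, Finset.mem_univ, true_and] at hc
      apply gcd_dvd_card_conjClass_mul
      by_cases hcm : c ^ m = 1
      · rw [card_pow_eq_of_pow_eq_one hnm hcm]
        refine ih _ ?_ _ ((Subgroup.card_subgroup_dvd_card _).trans hG) rfl
        refine lt_of_le_of_ne (Nat.card_le_card_of_injective _ Subtype.val_injective) fun h => hc ?_
        have h' := Subgroup.eq_top_of_card_eq _ h
        rw [Subgroup.mem_center_iff]
        intro g
        have : g ∈ Subgroup.centralizer {c} := h' ▸ Subgroup.mem_top g
        exact Subgroup.mem_centralizer_singleton_iff.1 this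
      · rw [hroot c hcm]; exact dvd_zero _
  -- The central `m`-torsion elements form a group of order coprime to `n`.
  let Z : Subgroup G :=
    { carrier := {c | c ∈ Subgroup.center G ∧ c ^ m = 1}
      mul_mem' := fun {a b} ha hb => ⟨mul_mem ha.1 hb.1, by
        rw [(show Commute a b from (Subgroup.mem_center_iff.1 hb.1 a)).mul_pow, ha.2, hb.2,
          one_mul]⟩
      one_mem' := ⟨one_mem _, one_pow _⟩
      inv_mem' := fun {a} ha => ⟨inv_mem ha.1, by rw [inv_pow, ha.2, inv_one]⟩ }
  have hZ : n.Coprime (Nat.card Z) := by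
    refine Nat.Coprime.symm (Nat.coprime_of_dvd fun p hp hpZ hpn => ?_)
    have := Fact.mk hp
    obtain ⟨z, hz⟩ := exists_prime_orderOf_dvd_card' p hpZ
    have h1 : orderOf z ∣ m := orderOf_dvd_of_pow_eq_one (Subtype.ext z.2.2)
    rw [hz] at h1
    exact hp.one_lt.ne' (Nat.eq_one_of_dvd_coprimes hnm hpn h1)
  have hcen : ∑ c with c ∈ Subgroup.center G, Nat.card {x : G // x ^ n = c} =
      Nat.card Z * Nat.card {x : G // x ^ n = 1} := by
    have h1 : ∑ c with c ∈ Subgroup.center G, Nat.card {x : G // x ^ n = c} =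
        ∑ c with c ∈ Z, Nat.card {x : G // x ^ n = 1} := by
      symm
      refine Finset.sum_subset_zero_on_sdiff ?_ ?_ ?_
      · intro c hc
        simp only [Finset.mem_filter, Finset.mem_univ, true_and] at hc ⊢
        exact hc.1
      · intro c hc
        simp only [Finset.mem_sdiff, Finset.mem_filter, Finset.mem_univ, true_and] at hc
        exact hroot c fun h => hc.2 ⟨hc.1, h⟩
      · intro c hc
        simp only [Finset.mem_filter, Finset.mem_univ, true_and] at hc
        rw [card_pow_eq_of_pow_eq_one hnm hc.2, card_pow_eq_of_pow_eq_one hnm (one_pow m)]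
        have e : Subgroup.centralizer {c} = Subgroup.centralizer {(1 : G)} := by
          ext g
          simp only [Subgroup.mem_centralizer_singleton_iff, mul_one, one_mul, iff_true]
          exact Subgroup.mem_center_iff.1 hc.1 g
        rw [e]
    rw [h1, Finset.sum_const, smul_eq_mul]
    congr 1
    rw [Nat.card_eq_fintype_card, ← Fintype.card_subtype]
  have hsplit := Finset.sum_filter_add_sum_filter_not Finset.univ (· ∈ Subgroup.center G)
    (fun c => Nat.card {x : G // x ^ n = c})
  rw [← htot, hcen] at hsplit
  have h3 : n.gcd (Nat.card G) ∣ Nat.card Z * Nat.card {x : G // x ^ n = 1} :=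
    (Nat.dvd_add_left hnc).1 (hsplit ▸ Nat.gcd_dvd_right _ _)
  exact (Nat.Coprime.coprime_dvd_left (Nat.gcd_dvd_left _ _) hZ).dvd_of_dvd_mul_left h3

/-- In a group of order `n * m` with `n`, `m` coprime, `n` divides the number of elements whose
`n`-th power has a given order. -/
theorem dvd_card_orderOf_pow_eq {n m : ℕ} (hnm : n.Coprime m) {G : Type*} [Group G] [Finite G]
    (hG : Nat.card G = n * m) (j : ℕ) :
    n ∣ Nat.card {x : G // orderOf (x ^ n) = j} := by
  classical
  have := Fintype.ofFinite G
  have hcount : Nat.card {x : G // orderOf (x ^ n) = j} =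
      ∑ c : G with orderOf c = j, Nat.card {x : G // x ^ n = c} := by
    simp only [Nat.card_eq_fintype_card, Fintype.card_subtype]
    rw [Finset.card_eq_sum_card_fiberwise (f := fun x : G => x ^ n)
      (t := Finset.univ.filter fun c : G => orderOf c = j)]
    · refine Finset.sum_congr rfl fun c hc => congrArg _ ?_
      ext x
      simp only [Finset.mem_filter, Finset.mem_univ, true_and, and_iff_right_iff_imp] at hc ⊢
      rintro rfl; exact hc
    · intro x hx
      simpa using hx
  have hgcd : n.gcd (Nat.card G) = n := by rw [hG, Nat.gcd_mul_right_right]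
  rw [hcount]
  conv_lhs => rw [← hgcd]
  refine dvd_sum_of_conj_invariant _ _ (fun x y h => card_pow_eq_conj n h) _ ?_ ?_
  · intro x y hxy hx
    simp only [Finset.mem_filter, Finset.mem_univ, true_and] at hx ⊢
    rw [← hx]
    obtain ⟨g, rfl⟩ := isConj_iff.1 hxy
    exact orderOf_injective (MulAut.conj g).toMonoidHom (MulAut.conj g).injective x
  · intro c _
    apply gcd_dvd_card_conjClass_mul
    by_cases hcm : c ^ m = 1
    · rw [card_pow_eq_of_pow_eq_one hnm hcm]
      exact gcd_dvd_card_pow_eq_one hnm _ ((Subgroup.card_subgroup_dvd_card _).trans hG.dvd)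
    · have : IsEmpty {x : G // x ^ n = c} := ⟨fun x => hcm (by
        rw [← x.2, ← pow_mul, ← hG, pow_card_eq_one'])⟩
      simp

/-! ### Counting elements by their orders -/

theorem numOfOrder_pos_of_mem_elementOrders {G : Type*} [Group G] [Finite G] {o : ℕ}
    (ho : o ∈ elementOrders G) : 0 < numOfOrder G o := by
  obtain ⟨x, hx⟩ := ho
  have : Nonempty {x : G // orderOf x = o} := ⟨⟨x, hx⟩⟩
  exact Nat.card_pos

theorem numOfOrder_one (G : Type*) [Group G] : numOfOrder G 1 = 1 := by
  unfold numOfOrder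
  simp only [orderOf_eq_one_iff]
  exact Nat.card_unique

/-- Elements selected by a condition on their order are counted order by order. -/
theorem card_orderOf_mem_eq_sum {G : Type*} [Group G] [Finite G] (P : ℕ → Prop)
    [DecidablePred P] :
    Nat.card {x : G // P (orderOf x)} =
      ∑ o ∈ (Nat.card G).divisors with P o, numOfOrder G o := by
  classical
  have := Fintype.ofFinite G
  simp only [numOfOrder, Nat.card_eq_fintype_card, Fintype.card_subtype]
  rw [Finset.card_eq_sum_card_fiberwise (f := fun x : G => orderOf x)
    (t := (Fintype.card G).divisors.filter P)]
  · refine Finset.sum_congr rfl fun o ho => congrArg _ ?_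
    ext x
    simp only [Finset.mem_filter, Finset.mem_univ, true_and, and_iff_right_iff_imp] at ho ⊢
    rintro rfl; exact ho.2
  · intro x hx
    have hx' : P (orderOf x) := by simpa using hx
    simp [hx', orderOf_dvd_card]

/-- Inversion pairs off the elements of order `o > 2`. -/
theorem even_numOfOrder {G : Type*} [Group G] [Finite G] {o : ℕ} (ho : 2 < o) :
    Even (numOfOrder G o) := by
  classical
  have := Fintype.ofFinite G
  unfold numOfOrder
  let f : {x : G // orderOf x = o} → {x : G // orderOf x = o} :=
    fun x => ⟨x.1⁻¹, by rw [orderOf_inv, x.2]⟩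
  have hf : f^[2 ^ 1] = id := by
    funext x; simp [f]
  have : Fact (Nat.Prime 2) := ⟨Nat.prime_two⟩
  have h := Equiv.Perm.card_fixedPoints_modEq (p := 2) (n := 1) (f := f) hf
  have h0 : IsEmpty f.fixedPoints := by
    refine ⟨fun x => ?_⟩
    have h1 : x.1.1⁻¹ = x.1.1 := congrArg Subtype.val x.2
    have h2 : x.1.1 ^ 2 = 1 := by
      rw [sq]; nth_rewrite 1 [← h1]; exact inv_mul_cancel _
    have := orderOf_le_of_pow_eq_one two_pos h2
    rw [x.1.2] at this
    omega
  rw [Nat.card_eq_fintype_card]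
  rw [Fintype.card_eq_zero (α := f.fixedPoints)] at h
  exact even_iff_two_dvd.2 ((Nat.modEq_zero_iff_dvd).1 h)

/-- Frobenius' congruence for a prime. An element `z` of order `u` acts on the solutions of
`x ^ u = 1` by conjugation, and on the fixed points of that action freely by translation. -/
theorem prime_dvd_card_pow_eq_one {G : Type*} [Group G] [Finite G] {u : ℕ} (hu : u.Prime)
    (h : u ∣ Nat.card G) : u ∣ Nat.card {x : G // x ^ u = 1} := by
  classical
  have := Fact.mk hu
  have := Fintype.ofFinite G
  obtain ⟨z, hz⟩ := exists_prime_orderOf_dvd_card' u h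
  have hzu : z ^ u = 1 := hz ▸ pow_orderOf_eq_one z
  let f : {x : G // x ^ u = 1} → {x : G // x ^ u = 1} :=
    fun x => ⟨MulAut.conj z x.1, by rw [← map_pow, x.2, map_one]⟩
  have hfit : ∀ (k : ℕ) x, (f^[k] x).1 = z ^ k * x.1 * (z ^ k)⁻¹ := by
    intro k
    induction k with
    | zero => intro x; simp
    | succ k ih =>
      intro x
      rw [Function.iterate_succ_apply, ih]
      simp [f, pow_succ, mul_assoc]
  have hf : f^[u ^ 1] = id := by
    funext x; apply Subtype.ext; rw [hfit, pow_one, hzu]; simp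
  have h1 := Equiv.Perm.card_fixedPoints_modEq (p := u) (n := 1) (f := f) hf
  have hcomm : ∀ x : f.fixedPoints, Commute z x.1.1 := by
    intro x
    have h2 : z * x.1.1 * z⁻¹ = x.1.1 := congrArg Subtype.val x.2
    exact mul_inv_eq_iff_eq_mul.1 h2
  let g : f.fixedPoints → f.fixedPoints := fun x =>
    ⟨⟨z * x.1.1, by rw [(hcomm x).mul_pow, hzu, x.1.2, one_mul]⟩, by
      apply Subtype.ext
      change z * (z * x.1.1) * z⁻¹ = z * x.1.1
      rw [mul_inv_eq_iff_eq_mul, mul_assoc, (hcomm x).eq]⟩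
  have hgit : ∀ (k : ℕ) x, (g^[k] x).1.1 = z ^ k * x.1.1 := by
    intro k
    induction k with
    | zero => intro x; simp
    | succ k ih =>
      intro x
      rw [Function.iterate_succ_apply, ih]
      simp [g, pow_succ, mul_assoc]
  have hg : g^[u ^ 1] = id := by
    funext x; apply Subtype.ext; apply Subtype.ext; rw [hgit, pow_one, hzu]; simp
  have h2 := Equiv.Perm.card_fixedPoints_modEq (p := u) (n := 1) (f := g) hg
  have h0 : IsEmpty g.fixedPoints := by
    refine ⟨fun x => ?_⟩
    have h3 : z * x.1.1.1 = x.1.1.1 := congrArg (fun y => y.1.1) x.2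
    have h4 : z = 1 := by simpa using h3
    rw [h4, orderOf_one] at hz
    exact hu.one_lt.ne hz
  rw [Fintype.card_eq_zero (α := g.fixedPoints)] at h2
  rw [Nat.card_eq_fintype_card]
  exact Nat.modEq_zero_iff_dvd.1 (h1.trans h2)

theorem prime_dvd_numOfOrder_add_one {G : Type*} [Group G] [Finite G] {u : ℕ} (hu : u.Prime)
    (h : u ∣ Nat.card G) : u ∣ numOfOrder G u + 1 := by
  have h1 := prime_dvd_card_pow_eq_one hu h
  have h2 : Nat.card {x : G // x ^ u = 1} = numOfOrder G u + 1 := by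
    have h3 : ∀ x : G, x ^ u = 1 ↔ orderOf x ∣ u := fun x => orderOf_dvd_iff_pow_eq_one.symm
    have h4 : (Nat.card G).divisors.filter (· ∣ u) = {1, u} := by
      ext o
      simp only [Finset.mem_filter, Nat.mem_divisors, Finset.mem_insert, Finset.mem_singleton]
      constructor
      · rintro ⟨-, ho⟩; exact (Nat.dvd_prime hu).1 ho
      · rintro (rfl | rfl)
        · exact ⟨⟨one_dvd _, Nat.card_pos.ne'⟩, one_dvd _⟩
        · exact ⟨⟨h, Nat.card_pos.ne'⟩, dvd_rfl⟩
    simp only [h3]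
    rw [card_orderOf_mem_eq_sum (· ∣ u), h4, Finset.sum_pair hu.one_lt.ne, numOfOrder_one, add_comm]
  rwa [h2] at h1

/-- The number of elements whose `n`-th power has order `j`, as a sum over orders. -/
theorem dvd_sum_numOfOrder {n m : ℕ} (hnm : n.Coprime m) {G : Type*} [Group G] [Finite G]
    (hG : Nat.card G = n * m) (j : ℕ) :
    n ∣ ∑ o ∈ (Nat.card G).divisors with o / o.gcd n = j, numOfOrder G o := by
  rw [← card_orderOf_mem_eq_sum (G := G) (fun o => o / o.gcd n = j)]
  simp only [← orderOf_pow]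
  exact dvd_card_orderOf_pow_eq hnm hG j

/-- A sum of the numbers `m_o(G)` over orders `o ≠ 1` falls short of `|G|`, so if `|G|` divides it,
no such `o` is the order of an element. -/
theorem not_mem_elementOrders_of_card_dvd_sum {G : Type*} [Group G] [Finite G] {T : Finset ℕ}
    (hT : T ⊆ (Nat.card G).divisors) (h1 : 1 ∉ T) (h : Nat.card G ∣ ∑ o ∈ T, numOfOrder G o)
    {o : ℕ} (ho : o ∈ T) : o ∉ elementOrders G := by
  intro hoG
  have htot := card_orderOf_mem_eq_sum (G := G) (fun _ => True)
  rw [Finset.filter_true, Nat.card_congr (Equiv.subtypeUnivEquiv fun _ => trivial)] at htot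
  have hlt : ∑ o ∈ T, numOfOrder G o < Nat.card G := by
    conv_rhs => rw [htot]
    exact Finset.sum_lt_sum_of_subset hT (Nat.one_mem_divisors.2 Nat.card_pos.ne') h1
      (by rw [numOfOrder_one]; exact one_pos) fun _ _ _ => Nat.zero_le _
  have hzero := Nat.eq_zero_of_dvd_of_lt h hlt
  have := Finset.sum_eq_zero_iff.1 hzero o ho
  exact (numOfOrder_pos_of_mem_elementOrders hoG).ne' this

/-- If every `m_o(G)` with `o ≠ 1` is divisible by `n` or by `m`, where `|G| = n * m` is a coprime
factorization, then `n ∣ m_o(G)` as soon as `o` does not divide `n`. -/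
theorem dvd_numOfOrder_of_not_dvd {n m : ℕ} (hnm : n.Coprime m) {G : Type*} [Group G] [Finite G]
    (hG : Nat.card G = n * m)
    (hdvd : ∀ o ∈ elementOrders G, o ≠ 1 → n ∣ numOfOrder G o ∨ m ∣ numOfOrder G o)
    {o : ℕ} (ho : o ∈ elementOrders G) (hon : ¬ o ∣ n) : n ∣ numOfOrder G o := by
  classical
  by_contra hcon
  set R := (Nat.card G).divisors.filter fun o' => o' / o'.gcd n = o / o.gcd n with hR
  have hodvd : o ∣ Nat.card G := by obtain ⟨x, rfl⟩ := ho; exact orderOf_dvd_natCard x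
  have h1R : 1 ∉ R := by
    intro h
    have h2 : 1 / Nat.gcd 1 n = o / o.gcd n := (Finset.mem_filter.1 h).2
    rw [Nat.gcd_one_left, Nat.div_one] at h2
    have h3 := Nat.div_mul_cancel (Nat.gcd_dvd_left o n)
    rw [← h2, one_mul] at h3
    exact hon (h3 ▸ Nat.gcd_dvd_right o n)
  have hsum := dvd_sum_numOfOrder hnm hG (o / o.gcd n)
  rw [← hR, ← Finset.sum_filter_add_sum_filter_not R (fun o' => n ∣ numOfOrder G o')] at hsum
  have hn := (Nat.dvd_add_right
    (Finset.dvd_sum fun o' ho' => (Finset.mem_filter.1 ho').2)).1 hsum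
  have hm : m ∣ ∑ o' ∈ R with ¬ n ∣ numOfOrder G o', numOfOrder G o' := by
    refine Finset.dvd_sum fun o' ho' => ?_
    obtain ⟨ho'R, hno'⟩ := Finset.mem_filter.1 ho'
    by_cases hoG : o' ∈ elementOrders G
    · exact (hdvd o' hoG (fun h => h1R (h ▸ ho'R))).resolve_left hno'
    · have : IsEmpty {x : G // orderOf x = o'} := ⟨fun x => hoG ⟨x.1, x.2⟩⟩
      rw [numOfOrder, Nat.card_of_isEmpty]
      exact dvd_zero m
  refine not_mem_elementOrders_of_card_dvd_sum (T := R.filter fun o' => ¬ n ∣ numOfOrder G o')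
    ((Finset.filter_subset _ _).trans (Finset.filter_subset _ _))
    (fun h => h1R (Finset.mem_filter.1 h).1)
    (hG ▸ hnm.mul_dvd_of_dvd_of_dvd hn hm) ?_ ho
  exact Finset.mem_filter.2
    ⟨Finset.mem_filter.2 ⟨Nat.mem_divisors.2 ⟨hodvd, Nat.card_pos.ne'⟩, rfl⟩, hcon⟩

/-- Under the same divisibility dichotomy, no element has order `u * r` with `u` a prime divisor
of `n` and `r` a prime divisor of `m`. -/
theorem mul_not_mem_elementOrders {n m : ℕ} (hnm : n.Coprime m) {G : Type*} [Group G] [Finite G]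
    (hG : Nat.card G = n * m)
    (hdvd : ∀ o ∈ elementOrders G, o ≠ 1 → n ∣ numOfOrder G o ∨ m ∣ numOfOrder G o)
    {u r : ℕ} (hu : u.Prime) (hr : r.Prime) (hun : u ∣ n) (hrm : r ∣ m) :
    u * r ∉ elementOrders G := by
  classical
  intro hur
  have huG : u ∈ elementOrders G := by
    have := Fact.mk hu
    obtain ⟨x, hx⟩ := exists_prime_orderOf_dvd_card' (G := G) u (hG ▸ hun.mul_right m)
    exact ⟨x, hx⟩
  have hu_m : Nat.gcd u m = 1 := Nat.Coprime.coprime_dvd_left hun hnm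
  -- `m_u(G) ≡ -1` modulo `u`, so of the two divisibilities only `m ∣ m_u(G)` is possible.
  have hmu : m ∣ numOfOrder G u := by
    refine (hdvd u huG hu.one_lt.ne').resolve_left fun h => ?_
    have h1 := prime_dvd_numOfOrder_add_one hu (hG ▸ hun.mul_right m)
    exact hu.one_lt.ne' (Nat.dvd_one.1 ((Nat.dvd_add_right (hun.trans h)).1 h1))
  set R := (Nat.card G).divisors.filter fun o => o / o.gcd m = u with hR
  have huR : u ∈ R := by
    refine Finset.mem_filter.2 ⟨Nat.mem_divisors.2 ⟨hG ▸ hun.mul_right m, Nat.card_pos.ne'⟩, ?_⟩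
    rw [hu_m, Nat.div_one]
  have hurR : u * r ∈ R := by
    refine Finset.mem_filter.2 ⟨Nat.mem_divisors.2
      ⟨hG ▸ mul_dvd_mul hun hrm, Nat.card_pos.ne'⟩, ?_⟩
    rw [Nat.Coprime.gcd_mul_left_cancel r (show Nat.Coprime u m from hu_m),
      Nat.gcd_eq_left hrm, Nat.mul_div_cancel _ hr.pos]
  have hsum := dvd_sum_numOfOrder hnm.symm (hG.trans (mul_comm _ _)) u (G := G)
  rw [← hR, ← Finset.add_sum_erase R _ huR] at hsum
  have hm := (Nat.dvd_add_right hmu).1 hsum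
  have hn : n ∣ ∑ o ∈ R.erase u, numOfOrder G o := by
    refine Finset.dvd_sum fun o ho => ?_
    obtain ⟨hou, hoR⟩ := Finset.mem_erase.1 ho
    by_cases hoG : o ∈ elementOrders G
    · refine dvd_numOfOrder_of_not_dvd hnm hG hdvd hoG fun hon => hou ?_
      have h1 := (Finset.mem_filter.1 hoR).2
      rwa [show Nat.gcd o m = 1 from Nat.Coprime.coprime_dvd_left hon hnm, Nat.div_one] at h1
    · have : IsEmpty {x : G // orderOf x = o} := ⟨fun x => hoG ⟨x.1, x.2⟩⟩
      rw [numOfOrder, Nat.card_of_isEmpty]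
      exact dvd_zero n
  refine not_mem_elementOrders_of_card_dvd_sum (T := R.erase u)
    ((Finset.erase_subset _ _).trans (Finset.filter_subset _ _)) (fun h => ?_)
    (hG ▸ hnm.mul_dvd_of_dvd_of_dvd hn hm) (Finset.mem_erase.2 ⟨fun h => ?_, hurR⟩) hur
  · have h1 := (Finset.mem_filter.1 (Finset.mem_of_mem_erase h)).2
    rw [Nat.gcd_one_left, Nat.div_one] at h1
    exact hu.one_lt.ne h1
  · exact hr.one_lt.ne' (Nat.eq_of_mul_eq_mul_left hu.pos (by rw [h, mul_one]))

/-! ### Matrices of prime order dividing `q ^ 2 + 1` -/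

section

open Polynomial

/-- If a prime `u ≠ 2` divides `q ^ 2 + 1`, then `q` has order `4` modulo `u`. -/
theorem eq_four_of_prime_dvd {q u d : ℕ} (hu : u.Prime) (hu2 : u ≠ 2) (hq : u ∣ q ^ 2 + 1)
    (hd0 : d ≠ 0) (hd4 : d ≤ 4) (h : q ^ d ≡ 1 [MOD u]) : d = 4 := by
  have := Fact.mk hu
  have h2 : (2 : ZMod u) ≠ 0 := by
    intro h
    have : (u : ℕ) ∣ 2 := (ZMod.natCast_eq_zero_iff 2 u).1 (by exact_mod_cast h)
    exact hu2 ((Nat.prime_dvd_prime_iff_eq hu Nat.prime_two).1 this)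
  have hq' : (q : ZMod u) ^ 2 + 1 = 0 := by
    exact_mod_cast (ZMod.natCast_eq_zero_iff (q ^ 2 + 1) u).2 hq
  have h' : (q : ZMod u) ^ d = 1 := by
    exact_mod_cast (ZMod.natCast_eq_natCast_iff _ _ _).2 h
  interval_cases d
  · exact absurd rfl hd0
  · exact absurd (by linear_combination hq' - ((q : ZMod u) + 1) * h') h2
  · exact absurd (by linear_combination hq' - h') h2
  · refine absurd ?_ h2
    linear_combination (1 + q - (q : ZMod u) ^ 2) * hq' - (1 - (q : ZMod u)) * h'
  · rfl

theorem card_adjoinRoot {F : Type*} [Field F] [Finite F] {h : F[X]} (hh : h ≠ 0) :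
    Nat.card (AdjoinRoot h) = Nat.card F ^ h.natDegree := by
  have := (AdjoinRoot.powerBasis hh).finite
  rw [Module.natCard_eq_pow_finrank (K := F), (AdjoinRoot.powerBasis hh).finrank,
    AdjoinRoot.powerBasis_dim]

/-- When `u` divides `q ^ 2 + 1`, an irreducible factor of `1 + X + ⋯ + X ^ (u - 1)` of degree
`d ≤ 4` has degree `4`: its root generates the field of `q ^ d` elements, whose multiplicative
group contains an element of order `u`. -/
theorem natDegree_eq_four_of_irreducible {F : Type*} [Field F] [Finite F] {u : ℕ} (hu : u.Prime)
    (hu2 : u ≠ 2) (hq : u ∣ Nat.card F ^ 2 + 1) {h : F[X]} (hh : Irreducible h)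
    (hdvd : h ∣ ∑ i ∈ Finset.range u, X ^ i) (hdeg : h.natDegree ≤ 4) : h.natDegree = 4 := by
  have := Fact.mk hu
  have := Fact.mk hh
  have hcard := card_adjoinRoot hh.ne_zero
  have hfin : Finite (AdjoinRoot h) := Nat.finite_of_card_ne_zero (by
    rw [hcard]; exact (pow_pos Nat.card_pos _).ne')
  set ζ := AdjoinRoot.root h with hζ
  have hsum : ∑ i ∈ Finset.range u, ζ ^ i = 0 := by
    have h1 : AdjoinRoot.mk h (∑ i ∈ Finset.range u, X ^ i) = 0 := AdjoinRoot.mk_eq_zero.2 hdvd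
    simpa using h1
  have hpow : ζ ^ u = 1 := by
    have := mul_geom_sum ζ u
    rw [hsum, mul_zero] at this
    exact (sub_eq_zero.1 this.symm)
  have hFu : (u : F) ≠ 0 := by
    intro h0
    have := Fintype.ofFinite F
    obtain ⟨p, hp⟩ := CharP.exists F
    obtain ⟨n, hpp, hn⟩ := FiniteField.card F p
    have h1 : p ∣ u := (CharP.cast_eq_zero_iff F p u).1 h0
    have h2 : p = u := (Nat.prime_dvd_prime_iff_eq hpp hu).1 h1
    rw [Nat.card_eq_fintype_card, hn, h2] at hq
    have h3 : u ∣ (u ^ (n : ℕ)) ^ 2 := dvd_pow (dvd_pow_self _ n.ne_zero) two_ne_zero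
    exact hu.one_lt.ne' (Nat.dvd_one.1 ((Nat.dvd_add_right h3).1 hq))
  have hne : ζ ≠ 1 := by
    intro h1
    rw [h1] at hsum
    simp only [one_pow, Finset.sum_const, Finset.card_range, nsmul_eq_mul, mul_one] at hsum
    apply hFu
    apply (algebraMap F (AdjoinRoot h)).injective
    rw [map_natCast, hsum, map_zero]
  have hζ0 : ζ ≠ 0 := by
    intro h0; rw [h0, zero_pow hu.ne_zero] at hpow; exact zero_ne_one hpow
  have hord : orderOf ζ = u := orderOf_eq_prime hpow hne
  have hord' : orderOf ζ ∣ Nat.card (AdjoinRoot h) - 1 := by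
    have := Fintype.ofFinite (AdjoinRoot h)
    rw [Nat.card_eq_fintype_card]
    exact orderOf_dvd_of_pow_eq_one (FiniteField.pow_card_sub_one_eq_one ζ hζ0)
  rw [hord, hcard] at hord'
  refine eq_four_of_prime_dvd hu hu2 hq hh.natDegree_pos.ne' hdeg ?_
  exact ((Nat.modEq_iff_dvd' (Nat.one_le_pow _ _ Nat.card_pos)).2 hord').symm

section

variable {F ι : Type*} [Field F] [Fintype ι] [DecidableEq ι]

theorem natDegree_minpoly_matrix_le (A : Matrix ι ι F) :
    (minpoly F A).natDegree ≤ Fintype.card ι := by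
  have := natDegree_le_of_dvd (Matrix.minpoly_dvd_charpoly A) (Matrix.charpoly_monic A).ne_zero
  rwa [Matrix.charpoly_natDegree_eq_dim] at this

/-- A `4 × 4` matrix over the field of `q` elements whose order is an odd prime divisor of
`q ^ 2 + 1` acts irreducibly. -/
theorem irreducible_minpoly_of_orderOf [Finite F] (hι : Fintype.card ι = 4) {u : ℕ}
    (hu : u.Prime) (hu2 : u ≠ 2) (hq : u ∣ Nat.card F ^ 2 + 1) {A : Matrix ι ι F}
    (hA : A ^ u = 1) (hA1 : A ≠ 1) :
    Irreducible (minpoly F A) ∧ (minpoly F A).natDegree = 4 := by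
  have hint : IsIntegral F A := Algebra.IsIntegral.isIntegral A
  have hle : (minpoly F A).natDegree ≤ 4 := hι ▸ natDegree_minpoly_matrix_le A
  have hnc : ¬ IsCoprime (∑ i ∈ Finset.range u, (X : F[X]) ^ i) (minpoly F A) := by
    rintro ⟨a, b, hab⟩
    have h1 := congrArg (aeval A) hab
    rw [map_add, map_mul, map_mul, minpoly.aeval, mul_zero, add_zero, map_one, map_sum] at h1
    simp only [map_pow, aeval_X] at h1
    have h2 : (∑ i ∈ Finset.range u, A ^ i) * (A - 1) = 0 := by
      rw [geom_sum_mul, hA, sub_self]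
    have h3 : A - 1 = 0 := by
      have h4 : aeval A a * (∑ i ∈ Finset.range u, A ^ i) * (A - 1) = A - 1 := by
        rw [h1, one_mul]
      rw [← h4, mul_assoc, h2, mul_zero]
    exact hA1 (sub_eq_zero.1 h3)
  obtain ⟨h, hh, hh1, hh2⟩ : ∃ h : F[X], Irreducible h ∧
      h ∣ (∑ i ∈ Finset.range u, (X : F[X]) ^ i) ∧ h ∣ minpoly F A := by
    by_contra hcon
    push Not at hcon
    refine hnc (isCoprime_of_irreducible_dvd (fun h0 => minpoly.ne_zero hint h0.2) ?_)
    exact fun z hz h1 h2 => hcon z hz h1 h2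
  have hd := natDegree_eq_four_of_irreducible hu hu2 hq hh hh1
    ((natDegree_le_of_dvd hh2 (minpoly.ne_zero hint)).trans hle)
  obtain ⟨c, hc⟩ := hh2
  have hc0 : c ≠ 0 := by rintro rfl; exact minpoly.ne_zero hint (by rw [hc, mul_zero])
  have hcd : (minpoly F A).natDegree = h.natDegree + c.natDegree := by
    rw [hc, natDegree_mul hh.ne_zero hc0]
  have hc1 : c.natDegree = 0 := by omega
  have hcu : IsUnit c := isUnit_iff_degree_eq_zero.2
    ((degree_eq_iff_natDegree_eq hc0).2 hc1)
  refine ⟨?_, by omega⟩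
  rw [hc]
  exact (irreducible_mul_isUnit hcu).2 hh

/-- Evaluation at `A` descends to the quotient by the minimal polynomial, which is a field when
`A` acts irreducibly. The matrix ring is not commutative, so `AdjoinRoot.liftAlgHom` does not
apply. -/
theorem exists_algHom_adjoinRoot_minpoly (A : Matrix ι ι F) :
    ∃ ψ : AdjoinRoot (minpoly F A) →ₐ[F] Matrix ι ι F,
      ∀ p : F[X], ψ (AdjoinRoot.mk _ p) = aeval A p := by
  refine ⟨Ideal.Quotient.liftₐ (Ideal.span {minpoly F A}) (aeval A) fun p hp => ?_, fun p => rfl⟩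
  obtain ⟨r, rfl⟩ := Ideal.mem_span_singleton.1 hp
  rw [map_mul, minpoly.aeval, zero_mul]

/-- A matrix that acts irreducibly with minimal polynomial of full degree is centralized only by
the polynomials in it: the underlying space is one-dimensional over the field they form. -/
theorem exists_aeval_eq_of_commute {A B : Matrix ι ι F} (hA : Irreducible (minpoly F A))
    (hdeg : (minpoly F A).natDegree = Fintype.card ι) (hAB : Commute A B) :
    ∃ p : F[X], aeval A p = B := by
  have := Fact.mk hA
  obtain ⟨ψ, hψ⟩ := exists_algHom_adjoinRoot_minpoly A
  have hne : Nonempty ι := by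
    rw [← Fintype.card_pos_iff, ← hdeg]
    exact hA.natDegree_pos
  obtain ⟨i⟩ := hne
  let v : ι → F := Pi.single i 1
  have hv : v ≠ 0 := fun h => one_ne_zero (α := F) (by simpa [v] using congrFun h i)
  let φ : AdjoinRoot (minpoly F A) →ₗ[F] (ι → F) :=
    { toFun := fun a => (ψ a).mulVec v
      map_add' := fun a b => by rw [map_add, Matrix.add_mulVec]
      map_smul' := fun c a => by rw [map_smul, Matrix.smul_mulVec, RingHom.id_apply] }
  have hinj : Function.Injective φ := by
    rw [← LinearMap.ker_eq_bot, LinearMap.ker_eq_bot']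
    intro a ha
    by_contra ha0
    have ha' : (ψ a).mulVec v = 0 := ha
    apply hv
    rw [← Matrix.one_mulVec v, ← map_one ψ, ← inv_mul_cancel₀ ha0, map_mul,
      ← Matrix.mulVec_mulVec, ha', Matrix.mulVec_zero]
  have hfr : Module.finrank F (AdjoinRoot (minpoly F A)) = Module.finrank F (ι → F) := by
    rw [Module.finrank_fintype_fun_eq_card, ← hdeg,
      (AdjoinRoot.powerBasis hA.ne_zero).finrank, AdjoinRoot.powerBasis_dim]
  have := (AdjoinRoot.powerBasis hA.ne_zero).finite
  have hsurj : Function.Surjective φ :=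
    (LinearMap.injective_iff_surjective_of_finrank_eq_finrank hfr).1 hinj
  have hcomm : ∀ c, Commute (ψ c) B := by
    intro c
    obtain ⟨p, rfl⟩ := AdjoinRoot.mk_surjective c
    rw [hψ]
    induction p using Polynomial.induction_on' with
    | add p r hp hr => rw [map_add]; exact hp.add_left hr
    | monomial n a =>
      rw [aeval_monomial]
      exact (Algebra.commute_algebraMap_left a B).mul_left (hAB.pow_left n)
  obtain ⟨a, ha⟩ := hsurj (B.mulVec v)
  have ha' : (ψ a).mulVec v = B.mulVec v := ha
  have hBa : ψ a = B := by
    apply Matrix.toLin'.injective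
    refine LinearMap.ext fun w => ?_
    obtain ⟨b, rfl⟩ := hsurj w
    change (ψ a).mulVec ((ψ b).mulVec v) = B.mulVec ((ψ b).mulVec v)
    rw [Matrix.mulVec_mulVec, Matrix.mulVec_mulVec, ← (hcomm b).eq, ← map_mul, mul_comm a b,
      map_mul, ← Matrix.mulVec_mulVec, ← Matrix.mulVec_mulVec, ha']
  obtain ⟨p, rfl⟩ := AdjoinRoot.mk_surjective a
  exact ⟨p, by rw [← hψ, hBa]⟩

end

/-! ### Centralizers in the symplectic group -/

section

variable {F : Type*} [Field F] {l : Type*} [Fintype l] [DecidableEq l]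

open Matrix

/-- On the polynomials in a symplectic matrix `A`, the adjoint for the symplectic form is the
substitution of `A⁻¹` for `A`. -/
theorem J_mul_transpose_aeval (A : symplecticGroup l F) (p : F[X]) :
    J l F * (aeval (A : Matrix (l ⊕ l) (l ⊕ l) F) p)ᵀ =
      aeval ((A⁻¹ : symplecticGroup l F) : Matrix (l ⊕ l) (l ⊕ l) F) p * J l F := by
  have hA : J l F * (A : Matrix (l ⊕ l) (l ⊕ l) F)ᵀ =
      ((A⁻¹ : symplecticGroup l F) : Matrix (l ⊕ l) (l ⊕ l) F) * J l F := by
    have h1 := SymplecticGroup.mem_iff.1 A.2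
    have h2 : ((A⁻¹ : symplecticGroup l F) : Matrix (l ⊕ l) (l ⊕ l) F) * A = 1 :=
      congrArg Subtype.val (inv_mul_cancel A)
    rw [← h1, ← mul_assoc, ← mul_assoc, h2, one_mul, h1]
  induction p using Polynomial.induction_on' with
  | add p r hp hr => rw [map_add, map_add, transpose_add, mul_add, add_mul, hp, hr]
  | monomial n a =>
    rw [aeval_monomial, aeval_monomial, transpose_mul, transpose_pow]
    have h3 : J l F * (A : Matrix (l ⊕ l) (l ⊕ l) F)ᵀ ^ n =
        ((A⁻¹ : symplecticGroup l F) : Matrix (l ⊕ l) (l ⊕ l) F) ^ n * J l F :=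
      (show SemiconjBy _ _ _ from hA).pow_right n
    rw [← mul_assoc, h3, algebraMap_eq_diagonal, diagonal_transpose, ← algebraMap_eq_diagonal,
      mul_assoc, ← Algebra.commutes, ← mul_assoc, ← Algebra.commutes]

/-- The symplectic matrices centralizing an element of prime order `u ∣ q ^ 2 + 1` in `Sp₄(q)`
lie in a field of matrices, on which the symplectic adjoint is `y ↦ y ^ q ^ 2`; hence they
satisfy `y ^ (q ^ 2 + 1) = 1` and form a cyclic group. -/
theorem card_centralizer_dvd_of_prime_orderOf [Finite F] (hl : Fintype.card l = 2) {u : ℕ}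
    (hu : u.Prime) (hu2 : u ≠ 2) (hq : u ∣ Nat.card F ^ 2 + 1) {g : symplecticGroup l F}
    (hg : orderOf g = u) :
    Nat.card (Subgroup.centralizer {g}) ∣ Nat.card F ^ 2 + 1 := by
  have hι : Fintype.card (l ⊕ l) = 4 := by rw [Fintype.card_sum, hl]
  have hgu : g ^ u = 1 := hg ▸ pow_orderOf_eq_one g
  have hg1 : g ≠ 1 := by rintro rfl; rw [orderOf_one] at hg; exact hu.one_lt.ne hg
  obtain ⟨hirr, hdeg⟩ := irreducible_minpoly_of_orderOf hι hu hu2 hq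
    (A := (g : Matrix (l ⊕ l) (l ⊕ l) F)) (by
      have := congrArg Subtype.val hgu; simpa using this)
    (fun h => hg1 (Subtype.ext h))
  have hpoly : ∀ y ∈ Subgroup.centralizer {g}, ∃ p : F[X],
      aeval (g : Matrix (l ⊕ l) (l ⊕ l) F) p = y := fun y hy =>
    exists_aeval_eq_of_commute hirr (hdeg.trans hι.symm)
      (congrArg Subtype.val (Subgroup.mem_centralizer_singleton_iff.1 hy)).symm
  have hginv : g⁻¹ = g ^ (Nat.card F ^ 2) := by
    rw [inv_eq_iff_mul_eq_one, ← pow_succ']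
    exact orderOf_dvd_iff_pow_eq_one.1 (hg ▸ hq)
  have hpow : ∀ y : Subgroup.centralizer {g}, y ^ (Nat.card F ^ 2 + 1) = 1 := by
    rintro ⟨y, hy⟩
    obtain ⟨p, hp⟩ := hpoly y hy
    apply Subtype.ext
    apply Subtype.ext
    -- Raising to the power `q` fixes the coefficients of `p`.
    have hfrob : aeval ((g⁻¹ : symplecticGroup l F) : Matrix (l ⊕ l) (l ⊕ l) F) p =
        (y : Matrix (l ⊕ l) (l ⊕ l) F) ^ (Nat.card F ^ 2) := by
      have := Fintype.ofFinite F
      rw [hginv, SubmonoidClass.coe_pow, ← expand_aeval, sq, ← expand_expand,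
        Nat.card_eq_fintype_card, FiniteField.expand_card, FiniteField.expand_card, ← pow_mul,
        map_pow, hp]
    -- `y` times its adjoint is `1`, and the adjoint is `y ^ q ^ 2`.
    have h1 := SymplecticGroup.mem_iff.1 y.2
    rw [mul_assoc] at h1
    nth_rewrite 2 [← hp] at h1
    rw [J_mul_transpose_aeval, hfrob, ← mul_assoc, ← pow_succ'] at h1
    have h2 := (isUnit_iff_isUnit_det _).2 (isUnit_det_J l F)
    exact h2.mul_right_cancel (h1.trans (one_mul _).symm)
  have hcyc : IsCyclic (Subgroup.centralizer {g}) := by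
    have := Fact.mk hirr
    obtain ⟨ψ, hψ⟩ := exists_algHom_adjoinRoot_minpoly (g : Matrix (l ⊕ l) (l ⊕ l) F)
    have hne : Nonempty (l ⊕ l) := by rw [← Fintype.card_pos_iff, hι]; norm_num
    have hinj : Function.Injective ψ := ψ.toRingHom.injective
    have hex : ∀ y : Subgroup.centralizer {g}, ∃ a, ψ a = (y : symplecticGroup l F) := by
      rintro ⟨y, hy⟩
      obtain ⟨p, hp⟩ := hpoly y hy
      exact ⟨AdjoinRoot.mk _ p, by rw [hψ, hp]⟩
    choose f hf using hex
    let f' : Subgroup.centralizer {g} →* AdjoinRoot (minpoly F (g : Matrix (l ⊕ l) (l ⊕ l) F)) :=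
      { toFun := f
        map_one' := hinj (by rw [hf, map_one]; rfl)
        map_mul' := fun a b => hinj (by rw [hf, map_mul, hf, hf]; rfl) }
    refine isCyclic_of_injective_ringHom f' fun a b hab => ?_
    apply Subtype.ext
    apply Subtype.ext
    rw [← hf, ← hf]
    exact congrArg ψ hab
  rw [← hcyc.exponent_eq_card]
  exact Monoid.exponent_dvd_of_forall_pow_eq_one hpow

/-- In `Sp₄(q)`, `q` even, the centralizer of `x ≠ 1` has order either prime to `q ^ 2 + 1` or
dividing it. -/
theorem card_centralizer_coprime_or_dvd [Finite F] (hl : Fintype.card l = 2)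
    (heven : Even (Nat.card F)) {x : symplecticGroup l F} (hx : x ≠ 1) :
    (Nat.card F ^ 2 + 1).Coprime (Nat.card (Subgroup.centralizer {x})) ∨
      Nat.card (Subgroup.centralizer {x}) ∣ Nat.card F ^ 2 + 1 := by
  have hodd : ∀ u, u ∣ Nat.card F ^ 2 + 1 → u ≠ 2 := by
    rintro u hu rfl
    have h1 : Even (Nat.card F ^ 2 + 1) := even_iff_two_dvd.2 hu
    exact (Nat.not_even_iff_odd.2 (heven.pow_of_ne_zero two_ne_zero).add_one) h1
  rw [or_iff_not_imp_left]
  intro hnc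
  obtain ⟨u, hu, huq, huc⟩ := Nat.Prime.not_coprime_iff_dvd.1 hnc
  have := Fact.mk hu
  obtain ⟨g, hg⟩ := exists_prime_orderOf_dvd_card' u huc
  have hg' : orderOf (g : symplecticGroup l F) = u := by rw [Subgroup.orderOf_coe, hg]
  have hxg : x ∈ Subgroup.centralizer {(g : symplecticGroup l F)} := by
    rw [Subgroup.mem_centralizer_singleton_iff]
    exact (Subgroup.mem_centralizer_singleton_iff.1 g.2).symm
  have hxord : orderOf x ∣ Nat.card F ^ 2 + 1 := by
    refine dvd_trans ?_ (card_centralizer_dvd_of_prime_orderOf hl hu (hodd u huq) huq hg')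
    have := orderOf_dvd_natCard (⟨x, hxg⟩ : Subgroup.centralizer {(g : symplecticGroup l F)})
    rwa [← Subgroup.orderOf_coe] at this
  obtain ⟨v, hv, hvx⟩ := Nat.exists_prime_and_dvd (n := orderOf x)
    (fun h => hx (orderOf_eq_one_iff.1 h))
  have hvord : orderOf (x ^ (orderOf x / v)) = v :=
    orderOf_pow_orderOf_div (orderOf_pos x).ne' hvx
  refine dvd_trans (Subgroup.card_dvd_of_le ?_) (card_centralizer_dvd_of_prime_orderOf hl hv
    (hodd v (hvx.trans hxord)) (hvx.trans hxord) hvord)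
  intro y hy
  rw [Subgroup.mem_centralizer_singleton_iff] at hy ⊢
  exact ((show Commute y x from hy).pow_right _).eq

end

end

/-! ### The order of the symplectic group -/

theorem card_fiber_mul_card {F V W : Type*} [Field F] [AddCommGroup V] [Module F V]
    [AddCommGroup W] [Module F W] (L : V →ₗ[F] W) (hL : Function.Surjective L) (w : W) :
    Nat.card {v // L v = w} * Nat.card W = Nat.card V := by
  obtain ⟨v₀, rfl⟩ := hL w
  have h1 : Nat.card {v // L v = L v₀} = Nat.card L.ker := by
    refine Nat.card_congr ((Equiv.addRight (-v₀)).subtypeEquiv fun v => ?_)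
    simp [LinearMap.mem_ker, ← sub_eq_add_neg, sub_eq_zero]
  rw [h1, ← Nat.card_congr (L.quotKerEquivOfSurjective hL).toEquiv, mul_comm]
  exact L.ker.toAddSubgroup.card_eq_card_quotient_mul_card_addSubgroup.symm

theorem card_sigma_of_card_eq {α : Type*} [Finite α] {β : α → Type*} [∀ a, Finite (β a)] {k : ℕ}
    (h : ∀ a, Nat.card (β a) = k) : Nat.card (Σ a, β a) = Nat.card α * k := by
  have := Fintype.ofFinite α
  rw [Nat.card_sigma, Finset.sum_congr rfl fun a _ => h a, Finset.sum_const, smul_eq_mul,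
    Finset.card_univ, Nat.card_eq_fintype_card]

/-- The quadruples `(a₁, b₁, a₂, b₂)` of vectors such that `(a₁, b₁)` and `(a₂, b₂)` are orthogonal
hyperbolic pairs, one vector at a time. The value `-1` of the form on each pair is that of the
rows of `Matrix.J`. -/
def SymplecticBasis {F V : Type*} [Field F] [AddCommGroup V] [Module F V]
    (B : LinearMap.BilinForm F V) : Type _ :=
  Σ a₁ : {a : V // a ≠ 0}, Σ b₁ : {b : V // B a₁ b = -1},
    Σ a₂ : {a : V // (B a₁ a = 0 ∧ B b₁ a = 0) ∧ a ≠ 0},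
      {b : V // B a₁ b = 0 ∧ B b₁ b = 0 ∧ B a₂ b = -1}

theorem card_symplecticBasis {F V : Type*} [Field F] [Finite F] [AddCommGroup V] [Module F V]
    [Finite V] (B : LinearMap.BilinForm F V) (hB : B.IsAlt)
    (hnd : ∀ a, a ≠ 0 → ∃ b, B a b = 1) (hV : Nat.card V = Nat.card F ^ 4) :
    Nat.card (SymplecticBasis B) =
      (Nat.card F ^ 4 - 1) * (Nat.card F ^ 3 * ((Nat.card F ^ 2 - 1) * Nat.card F)) := by
  have hq : 0 < Nat.card F := Nat.card_pos
  have hne : ∀ (P : V → Prop) (_ : P 0),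
      Nat.card {a : V // P a ∧ a ≠ 0} = Nat.card {a : V // P a} - 1 := by
    intro P h0
    classical
    have := Fintype.ofFinite V
    simp only [Nat.card_eq_fintype_card, Fintype.card_subtype]
    rw [← Finset.card_erase_of_mem (a := (0 : V)) (by simpa using h0)]
    congr 1
    ext a
    simp [and_comm]
  have hsurj₁ : ∀ a, a ≠ 0 → Function.Surjective (B a) := by
    intro a ha c
    obtain ⟨b, hb⟩ := hnd a ha
    exact ⟨c • b, by simp [hb]⟩
  have hsurj₂ : ∀ a b, B a b = -1 → Function.Surjective ((B a).prod (B b)) := by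
    rintro a b hab ⟨c, d⟩
    have hba : B b a = 1 := by rw [← hB.neg_eq, hab, neg_neg]
    exact ⟨d • a - c • b, by simp [hab, hba, hB.self_eq_zero]⟩
  have hsurj₃ : ∀ a b a', B a b = -1 → (B a a' = 0 ∧ B b a' = 0) ∧ a' ≠ 0 →
      Function.Surjective ((B a).prod ((B b).prod (B a'))) := by
    rintro a b a' hab ⟨⟨haa', hba'⟩, ha'⟩ ⟨c, d, e⟩
    have hba : B b a = 1 := by rw [← hB.neg_eq, hab, neg_neg]
    have ha'a : B a' a = 0 := by rw [← hB.neg_eq, haa', neg_zero]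
    have ha'b : B a' b = 0 := by rw [← hB.neg_eq, hba', neg_zero]
    obtain ⟨w, hw⟩ := hnd a' ha'
    refine ⟨e • w + (d - e * B b w) • a - (c - e * B a w) • b, ?_⟩
    simp [hab, hba, ha'a, ha'b, hw, hB.self_eq_zero]
  have h1 : Nat.card {a : V // a ≠ 0} = Nat.card F ^ 4 - 1 := by
    rw [← hV, ← Nat.card_congr (Equiv.subtypeUnivEquiv (p := fun _ : V => True) fun _ => trivial),
      ← hne _ trivial]
    simp
  have h2 : ∀ a : {a : V // a ≠ 0}, Nat.card {b : V // B a b = -1} = Nat.card F ^ 3 := by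
    intro a
    have h := card_fiber_mul_card (B a) (hsurj₁ a a.2) (-1)
    rw [hV, pow_succ] at h
    exact Nat.eq_of_mul_eq_mul_right hq h
  have h3 : ∀ (a : {a : V // a ≠ 0}) (b : {b : V // B a b = -1}),
      Nat.card {a' : V // (B a a' = 0 ∧ B b a' = 0) ∧ a' ≠ 0} = Nat.card F ^ 2 - 1 := by
    intro a b
    rw [hne (fun a' => B a a' = 0 ∧ B b a' = 0) (by simp)]
    congr 1
    have h := card_fiber_mul_card _ (hsurj₂ a b b.2) (0, 0)
    have e : Nat.card {v : V // ((B a).prod (B b)) v = (0, 0)} =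
        Nat.card {v : V // B a v = 0 ∧ B b v = 0} :=
      Nat.card_congr (Equiv.subtypeEquivRight fun v => by simp)
    rw [e, hV, Nat.card_prod, pow_add _ 2 2, ← sq] at h
    exact Nat.eq_of_mul_eq_mul_right (pow_pos hq 2) h
  have h4 : ∀ (a : {a : V // a ≠ 0}) (b : {b : V // B a b = -1})
      (a' : {a' : V // (B a a' = 0 ∧ B b a' = 0) ∧ a' ≠ 0}),
      Nat.card {b' : V // B a b' = 0 ∧ B b b' = 0 ∧ B a' b' = -1} = Nat.card F := by
    intro a b a'
    have h := card_fiber_mul_card _ (hsurj₃ a b a' b.2 a'.2) (0, 0, -1)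
    have e : Nat.card {v : V // ((B a).prod ((B b).prod (B a'))) v = (0, 0, -1)} =
        Nat.card {v : V // B a v = 0 ∧ B b v = 0 ∧ B a' v = -1} :=
      Nat.card_congr (Equiv.subtypeEquivRight fun v => by simp)
    rw [e, hV, Nat.card_prod, Nat.card_prod] at h
    refine Nat.eq_of_mul_eq_mul_right (pow_pos hq 3) (Eq.trans ?_ (h.trans ?_)) <;> ring
  unfold SymplecticBasis
  rw [card_sigma_of_card_eq fun a => (card_sigma_of_card_eq fun b =>
    (card_sigma_of_card_eq fun a' => h4 a b a').trans (by rw [h3 a b])).trans (by rw [h2 a]), h1]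

open Matrix in
theorem card_symplecticGroup_four {F : Type*} [Field F] [Finite F] :
    Nat.card (symplecticGroup (Fin 2) F) =
      (Nat.card F ^ 2 + 1) * (Nat.card F ^ 4 * (Nat.card F ^ 2 - 1) ^ 2) := by
  obtain ⟨B, hBdef⟩ : ∃ B, B = Matrix.toBilin' (J (Fin 2) F) := ⟨_, rfl⟩
  have hBapp : ∀ v w, B v w =
      v (.inr 0) * w (.inl 0) + v (.inr 1) * w (.inl 1)
        - v (.inl 0) * w (.inr 0) - v (.inl 1) * w (.inr 1) := by
    intro v w
    simp only [hBdef, Matrix.toBilin'_apply', J, dotProduct, mulVec, Fintype.sum_sum_type,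
      Fin.sum_univ_two, fromBlocks_apply₁₁, fromBlocks_apply₁₂, fromBlocks_apply₂₁,
      fromBlocks_apply₂₂, Matrix.zero_apply, Matrix.neg_apply, Matrix.one_apply]
    simp
    ring
  have hB : B.IsAlt := by
    intro v
    rw [hBapp]; ring
  have hnd : ∀ a, a ≠ 0 → ∃ b, B a b = 1 := by
    intro a ha
    by_contra hcon
    have h0 : ∀ b, B a b = 0 := by
      intro b
      by_contra hb
      exact hcon ⟨(B a b)⁻¹ • b, by simp [hb]⟩
    apply ha
    funext i
    rcases i with i | i
    · have := h0 (Pi.single (.inr i) 1)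
      fin_cases i <;> simpa [hBapp] using this
    · have := h0 (Pi.single (.inl i) 1)
      fin_cases i <;> simpa [hBapp] using this
  have hV : Nat.card (Fin 2 ⊕ Fin 2 → F) = Nat.card F ^ 4 := by
    rw [Nat.card_fun]; simp
  have hmem : ∀ A : Matrix (Fin 2 ⊕ Fin 2) (Fin 2 ⊕ Fin 2) F, A ∈ symplecticGroup (Fin 2) F ↔
      ∀ i j, B (A i) (A j) = J (Fin 2) F i j := by
    intro A
    rw [SymplecticGroup.mem_iff, ← Matrix.ext_iff]
    refine forall_congr' fun i => forall_congr' fun j => ?_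
    rw [hBdef, Matrix.toBilin'_apply', Matrix.mul_assoc, Matrix.mul_apply']
    rfl
  have e : symplecticGroup (Fin 2) F ≃ SymplecticBasis B :=
    { toFun := fun A => ⟨⟨A.1 (.inl 0), by
          intro h
          have := (hmem _).1 A.2 (.inl 0) (.inr 0)
          rw [h] at this
          simp [J] at this⟩,
        ⟨A.1 (.inr 0), by rw [(hmem _).1 A.2]; simp [J]⟩,
        ⟨A.1 (.inl 1), ⟨by rw [(hmem _).1 A.2]; simp [J], by rw [(hmem _).1 A.2]; simp [J]⟩, by
          intro h
          have := (hmem _).1 A.2 (.inl 1) (.inr 1)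
          rw [h] at this
          simp [J] at this⟩,
        ⟨A.1 (.inr 1), by rw [(hmem _).1 A.2]; simp [J], by rw [(hmem _).1 A.2]; simp [J],
          by rw [(hmem _).1 A.2]; simp [J]⟩⟩
      invFun := fun t => ⟨Matrix.of (Sum.elim ![t.1.1, t.2.2.1.1] ![t.2.1.1, t.2.2.2.1]), by
        obtain ⟨⟨a, ha⟩, ⟨b, hb⟩, ⟨a', ⟨h1, h2⟩, ha'⟩, ⟨b', h3, h4, h5⟩⟩ := t
        dsimp only at hb h1 h2 h3 h4 h5
        rw [hmem]
        have hs := hB.neg_eq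
        have hb' : B b a = 1 := by rw [← hs, hb, neg_neg]
        have h1' : B a' a = 0 := by rw [← hs, h1, neg_zero]
        have h2' : B a' b = 0 := by rw [← hs, h2, neg_zero]
        have h3' : B b' a = 0 := by rw [← hs, h3, neg_zero]
        have h4' : B b' b = 0 := by rw [← hs, h4, neg_zero]
        have h5' : B b' a' = 1 := by rw [← hs, h5, neg_neg]
        change ∀ i j, B (Sum.elim ![a, a'] ![b, b'] i) (Sum.elim ![a, a'] ![b, b'] j) = _
        rintro (i | i) (j | j) <;> fin_cases i <;> fin_cases j <;>
          simp [J, hb, h1, h2, h3, h4, h5, hb', h1', h2', h3', h4', h5', hB.self_eq_zero]⟩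
      left_inv := fun A => by
        apply Subtype.ext
        ext i j
        rcases i with i | i <;> fin_cases i <;> rfl
      right_inv := fun t => rfl }
  rw [Nat.card_congr e, card_symplecticBasis B hB hnd hV]
  obtain ⟨k, hk⟩ : ∃ k, Nat.card F ^ 2 = k + 1 :=
    ⟨_, (Nat.sub_add_cancel (Nat.one_le_pow 2 _ Nat.card_pos)).symm⟩
  have h4 : Nat.card F ^ 4 - 1 = k * (k + 2) := by
    rw [show Nat.card F ^ 4 = k * (k + 2) + 1 by rw [pow_mul (Nat.card F) 2 2, hk]; ring]
    rfl
  rw [h4, hk, Nat.add_sub_cancel]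
  ring

/-! ### The symplectic group and its numbers of elements of given order -/

theorem numOfOrder_congr {G H : Type*} [Group G] [Group H] (e : G ≃* H) (o : ℕ) :
    numOfOrder G o = numOfOrder H o :=
  Nat.card_congr (e.toEquiv.subtypeEquiv fun x => by
    rw [MulEquiv.toEquiv_eq_coe, MulEquiv.coe_toEquiv, e.orderOf_eq])

theorem nse_congr {G H : Type*} [Group G] [Group H] (e : G ≃* H) : nse G = nse H := by
  have h : elementOrders G = elementOrders H := by
    ext o
    constructor
    · rintro ⟨x, rfl⟩; exact ⟨e x, e.orderOf_eq x⟩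
    · rintro ⟨x, rfl⟩; exact ⟨e.symm x, e.symm.orderOf_eq x⟩
  unfold nse
  rw [h]
  exact Set.image_congr fun o _ => numOfOrder_congr e o

/-- If each centralizer of a nontrivial element has order prime to `n` or dividing `n`, then
elements of the same order fall into the same case, and their classes have sizes divisible by `n`
in the first case and by `|G| / n` in the second. -/
theorem dvd_numOfOrder_of_centralizers {G : Type*} [Group G] [Finite G] {n m : ℕ}
    (hG : Nat.card G = n * m)
    (hcent : ∀ x : G, x ≠ 1 → n.Coprime (Nat.card (Subgroup.centralizer {x})) ∨
      Nat.card (Subgroup.centralizer {x}) ∣ n) {o : ℕ} (ho : o ≠ 1) :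
    n ∣ numOfOrder G o ∨ m ∣ numOfOrder G o := by
  classical
  have := Fintype.ofFinite G
  have hsum : numOfOrder G o = ∑ _x : G with orderOf _x = o, 1 := by
    rw [Finset.sum_const, smul_eq_mul, mul_one, numOfOrder, Nat.card_eq_fintype_card,
      Fintype.card_subtype]
  have hred : ∀ d : ℕ, (∀ x : G, orderOf x = o →
      d ∣ Nat.card {y : G // ConjClasses.mk y = ConjClasses.mk x}) → d ∣ numOfOrder G o := by
    intro d hd
    rw [hsum]
    refine dvd_sum_of_conj_invariant d _ (fun _ _ _ => rfl) _ ?_ ?_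
    · intro x y hxy hx
      simp only [Finset.mem_filter, Finset.mem_univ, true_and] at hx ⊢
      rw [← hx]
      obtain ⟨g, rfl⟩ := isConj_iff.1 hxy
      exact (MulAut.conj g).orderOf_eq x
    · intro x hx
      rw [mul_one]
      exact hd x (Finset.mem_filter.1 hx).2
  have hself : ∀ x : G, orderOf x ∣ Nat.card (Subgroup.centralizer {x}) := by
    intro x
    have := orderOf_dvd_natCard
      (⟨x, Subgroup.mem_centralizer_singleton_iff.2 rfl⟩ : Subgroup.centralizer {x})
    rwa [← Subgroup.orderOf_coe] at this
  have hne : ∀ x : G, orderOf x = o → x ≠ 1 := by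
    rintro x hx rfl
    exact ho (hx ▸ orderOf_one)
  by_cases hon : n.Coprime o
  · refine Or.inl (hred n fun x hx => ?_)
    have hcop := (hcent x (hne x hx)).resolve_right fun h =>
      ho (Nat.eq_one_of_dvd_coprimes hon (hx ▸ (hself x).trans h) dvd_rfl)
    refine hcop.dvd_of_dvd_mul_right ?_
    rw [card_conjClass_mul_card_centralizer, hG]
    exact dvd_mul_right n m
  · refine Or.inr (hred m fun x hx => ?_)
    obtain ⟨k, hk⟩ := (hcent x (hne x hx)).resolve_left fun h =>
      hon (Nat.Coprime.coprime_dvd_right (hx ▸ hself x) h)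
    have h := card_conjClass_mul_card_centralizer x
    rw [hG, hk, mul_comm, mul_assoc] at h
    exact ⟨k, by rw [Nat.eq_of_mul_eq_mul_left Nat.card_pos h, mul_comm]⟩

/-- In a group of even order with trivial centre the number of involutions is odd and is not `1`,
for a unique involution would be central. -/
theorem exists_odd_mem_nse {G : Type*} [Group G] [Finite G] (h2 : 2 ∣ Nat.card G)
    (hZ : Subgroup.center G = ⊥) : ∃ v ∈ nse G, Odd v ∧ v ≠ 1 := by
  have : Fact (Nat.Prime 2) := ⟨Nat.prime_two⟩
  obtain ⟨x, hx⟩ := exists_prime_orderOf_dvd_card' (G := G) 2 h2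
  refine ⟨numOfOrder G 2, ⟨2, ⟨x, hx⟩, rfl⟩, ?_, fun h1 => ?_⟩
  · have h := even_iff_two_dvd.2 (prime_dvd_numOfOrder_add_one Nat.prime_two h2)
    exact Nat.not_even_iff_odd.1 (Nat.even_add_one.1 h)
  · obtain ⟨hsub, -⟩ := Nat.card_eq_one_iff_unique.1 h1
    have hxZ : x ∈ Subgroup.center G := by
      rw [Subgroup.mem_center_iff]
      intro g
      have h3 : orderOf (g * x * g⁻¹) = 2 := by
        rw [← hx]; exact (MulAut.conj g).orderOf_eq x
      have h4 := congrArg Subtype.val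
        (hsub.elim (⟨g * x * g⁻¹, h3⟩ : {x : G // orderOf x = 2}) ⟨x, hx⟩)
      exact mul_inv_eq_iff_eq_mul.1 h4
    rw [hZ, Subgroup.mem_bot] at hxZ
    rw [hxZ, orderOf_one] at hx
    exact absurd hx (by norm_num)

theorem center_symplecticGroup_four_eq_bot {F : Type*} [Field F] [Finite F]
    (heven : Even (Nat.card F)) :
    Subgroup.center (Matrix.symplecticGroup (Fin 2) F) = ⊥ := by
  rw [Subgroup.eq_bot_iff_forall]
  intro z hz
  by_contra hz1
  have hq : 2 ≤ Nat.card F := Finite.one_lt_card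
  have hq2 : 4 ≤ Nat.card F ^ 2 := Nat.pow_le_pow_left hq 2
  have hm : 1 < Nat.card F ^ 4 * (Nat.card F ^ 2 - 1) ^ 2 := by
    have h1 : 1 < Nat.card F ^ 4 := Nat.one_lt_pow four_ne_zero hq
    have h2 : 0 < (Nat.card F ^ 2 - 1) ^ 2 := pow_pos (by omega) 2
    exact lt_of_lt_of_le h1 (Nat.le_mul_of_pos_right _ h2)
  have htop : Nat.card (Subgroup.centralizer {z}) =
      (Nat.card F ^ 2 + 1) * (Nat.card F ^ 4 * (Nat.card F ^ 2 - 1) ^ 2) := by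
    rw [← card_symplecticGroup_four, Subgroup.centralizer_eq_top_iff_subset.2
      (Set.singleton_subset_iff.2 hz), Subgroup.card_top]
  rcases card_centralizer_coprime_or_dvd (Fintype.card_fin 2) heven hz1 with h | h
  · rw [htop] at h
    have := Nat.eq_one_of_dvd_coprimes h dvd_rfl (dvd_mul_right _ _)
    omega
  · rw [htop] at h
    have := Nat.le_of_dvd (Nat.succ_pos _) h
    exact absurd this (not_le.2 (lt_mul_of_one_lt_right (Nat.succ_pos _) hm))

/-- In even characteristic `Sp₄` has trivial centre. -/
theorem nonempty_PSp_mulEquiv {F : Type*} [Field F] [Finite F] (heven : Even (Nat.card F)) :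
    Nonempty (PSp (Fin 2) F ≃* Matrix.symplecticGroup (Fin 2) F) :=
  ⟨(QuotientGroup.quotientMulEquivOfEq (center_symplecticGroup_four_eq_bot heven)).trans
    QuotientGroup.quotientBot⟩

theorem coprime_sq_add_one {q : ℕ} (hq : 2 ≤ q) (heven : Even q) :
    (q ^ 2 + 1).Coprime (q ^ 4 * (q ^ 2 - 1) ^ 2) := by
  obtain ⟨k, hk⟩ : ∃ k, q ^ 2 = k + 1 :=
    ⟨_, (Nat.sub_add_cancel (Nat.one_le_pow 2 _ (by omega))).symm⟩
  have h1 : (q ^ 2 + 1).Coprime q := by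
    rw [sq, Nat.coprime_mul_right_add_left]; exact Nat.coprime_one_left q
  have hkodd : Odd k := by
    have h := heven.pow_of_ne_zero two_ne_zero
    rw [hk, Nat.even_add_one, Nat.not_even_iff_odd] at h
    exact h
  have h2 : (q ^ 2 + 1).Coprime (q ^ 2 - 1) := by
    rw [hk, Nat.add_sub_cancel, add_assoc, Nat.coprime_self_add_left]
    exact (Nat.coprime_two_left).2 hkodd
  exact (h1.pow_right 4).mul_right (h2.pow_right 2)

/-- The divisibility dichotomy passes from `S` to any group with the same set of numbers `m_o`. The value `1` needs care: it is attained at `o = 1`, and it could only be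
attained again at `o = 2`, which an odd value different from `1` prevents. -/
theorem dvd_numOfOrder_of_nse_eq {G S : Type*} [Group G] [Finite G] [Group S] [Finite S]
    (hnse : nse G = nse S) {n m : ℕ} (hS : ∀ o, o ≠ 1 → n ∣ numOfOrder S o ∨ m ∣ numOfOrder S o)
    (hodd : ∃ v ∈ nse S, Odd v ∧ v ≠ 1) {o : ℕ} (ho : o ∈ elementOrders G) (ho1 : o ≠ 1) :
    n ∣ numOfOrder G o ∨ m ∣ numOfOrder G o := by
  have hle : ∀ o ∈ elementOrders G, Odd (numOfOrder G o) → o = 1 ∨ o = 2 := by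
    rintro _ ⟨x, rfl⟩ h
    have h1 := orderOf_pos x
    have h2 : ¬ 2 < orderOf x := fun h2 => Nat.not_even_iff_odd.2 h (even_numOfOrder h2)
    change orderOf x = 1 ∨ orderOf x = 2
    omega
  have hmem : numOfOrder G o ∈ nse S := hnse ▸ ⟨o, ho, rfl⟩
  obtain ⟨o', ho', he⟩ := hmem
  by_cases ho'1 : o' = 1
  · exfalso
    rw [ho'1, numOfOrder_one] at he
    have ho2 : o = 2 := (hle o ho (he ▸ odd_one)).resolve_left ho1
    obtain ⟨v, hv, hvodd, hv1⟩ := hodd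
    rw [← hnse] at hv
    obtain ⟨k, hk, rfl⟩ := hv
    rcases hle k hk hvodd with rfl | rfl
    · exact hv1 (numOfOrder_one G)
    · exact hv1 (ho2 ▸ he.symm)
  · rw [← he]
    exact hS o' ho'1

/-! ### Components of the prime graph -/

/-- A set of vertices that no edge leaves is a union of components. -/
theorem connectedComponentMk_ne {V : Type*} {Γ : SimpleGraph V} {P : V → Prop}
    (h : ∀ v w, Γ.Adj v w → P v → P w) {a b : V} (ha : P a) (hb : ¬ P b) :
    Γ.connectedComponentMk a ≠ Γ.connectedComponentMk b := by
  intro hab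
  obtain ⟨w⟩ := SimpleGraph.ConnectedComponent.exact hab
  clear hab
  induction w with
  | nil => exact hb ha
  | cons hadj _ ih => exact ih (h _ _ hadj ha) hb

theorem proposition4p2 (q : ℕ) (hq : 2 < q) (hq_even : Even q)
    (F : Type*) [Field F] [Finite F] (hF : Nat.card F = q)
    (G : Type*) [Group G] [Finite G]
    (hcard : Nat.card G = Nat.card (PSp (Fin 2) F))
    (hnse : nse G = nse (PSp (Fin 2) F)) :
    (∀ p₁ ∈ (q ^ 2 + 1).primeFactors, ∀ p₂ ∈ (2 * (q ^ 2 - 1)).primeFactors,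
      ∃ (h₁ : p₁ ∈ (Nat.card G).primeFactors) (h₂ : p₂ ∈ (Nat.card G).primeFactors),
        (primeGraph G).connectedComponentMk ⟨p₁, h₁⟩ ≠
          (primeGraph G).connectedComponentMk ⟨p₂, h₂⟩) ∧
    2 ≤ Nat.card (primeGraph G).ConnectedComponent := by
  subst hF
  set n := Nat.card F ^ 2 + 1 with hn
  set m := Nat.card F ^ 4 * (Nat.card F ^ 2 - 1) ^ 2 with hm
  have hq4 : 4 ≤ Nat.card F ^ 2 := Nat.pow_le_pow_left hq.le 2
  have hnm : n.Coprime m := coprime_sq_add_one hq.le hq_even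
  obtain ⟨e⟩ := nonempty_PSp_mulEquiv hq_even
  have hS : Nat.card (Matrix.symplecticGroup (Fin 2) F) = n * m := card_symplecticGroup_four
  have hG : Nat.card G = n * m := by rw [hcard, Nat.card_congr e.toEquiv, hS]
  have h2m : 2 ∣ m := ((even_iff_two_dvd.1 hq_even).trans (dvd_pow_self _ four_ne_zero)).mul_right _
  have hdvd : ∀ o ∈ elementOrders G, o ≠ 1 → n ∣ numOfOrder G o ∨ m ∣ numOfOrder G o :=
    fun o ho ho1 => dvd_numOfOrder_of_nse_eq (hnse.trans (nse_congr e))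
      (fun o ho1 => dvd_numOfOrder_of_centralizers hS
        (fun x hx => card_centralizer_coprime_or_dvd (Fintype.card_fin 2) hq_even hx) ho1)
      (exists_odd_mem_nse (hS ▸ h2m.mul_left n) (center_symplecticGroup_four_eq_bot hq_even)) ho ho1
  have hmain : ∀ p₁ ∈ n.primeFactors, ∀ p₂ ∈ (2 * (Nat.card F ^ 2 - 1)).primeFactors,
      ∃ (h₁ : p₁ ∈ (Nat.card G).primeFactors) (h₂ : p₂ ∈ (Nat.card G).primeFactors),
        (primeGraph G).connectedComponentMk ⟨p₁, h₁⟩ ≠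
          (primeGraph G).connectedComponentMk ⟨p₂, h₂⟩ := by
    intro p₁ hp₁ p₂ hp₂
    have hp₁' := Nat.dvd_of_mem_primeFactors hp₁
    have hpr₁ := Nat.prime_of_mem_primeFactors hp₁
    have hpr₂ := Nat.prime_of_mem_primeFactors hp₂
    have hp₂' : p₂ ∣ m := by
      rcases hpr₂.dvd_mul.1 (Nat.dvd_of_mem_primeFactors hp₂) with h | h
      · exact h.trans h2m
      · exact (h.trans (dvd_pow_self _ two_ne_zero)).mul_left _
    refine ⟨Nat.mem_primeFactors.2 ⟨hpr₁, hG ▸ hp₁'.mul_right m, Nat.card_pos.ne'⟩,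
      Nat.mem_primeFactors.2 ⟨hpr₂, hG ▸ hp₂'.mul_left n, Nat.card_pos.ne'⟩, ?_⟩
    refine connectedComponentMk_ne (Γ := primeGraph G) (P := fun v => v.1 ∣ n) (a := ⟨p₁, _⟩)
      (b := ⟨p₂, _⟩) ?_ hp₁' fun h => hpr₂.one_lt.ne' (Nat.eq_one_of_dvd_coprimes hnm h hp₂')
    rintro ⟨v, hv⟩ ⟨w, hw⟩ ⟨-, hvw⟩ hvn
    have hvp := Nat.prime_of_mem_primeFactors hv
    have hwp := Nat.prime_of_mem_primeFactors hw
    refine (hwp.dvd_mul.1 (hG ▸ Nat.dvd_of_mem_primeFactors hw)).resolve_right fun hwm => ?_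
    exact mul_not_mem_elementOrders hnm hG hdvd hvp hwp hvn hwm hvw
  refine ⟨hmain, ?_⟩
  obtain ⟨p, hp, hpn⟩ := Nat.exists_prime_and_dvd (n := n) (by omega)
  obtain ⟨_, _, hne⟩ := hmain p (Nat.mem_primeFactors.2 ⟨hp, hpn, by omega⟩) 2
    (Nat.mem_primeFactors.2 ⟨Nat.prime_two, dvd_mul_right _ _, by omega⟩)
  exact Finite.one_lt_card_iff_nontrivial.2 ⟨_, _, hne⟩
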